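/- Let $P(t_1,t_2)=\sum_{\mathfrak m\in\Lambda(P)}c_{\mathfrak m}t^{\mathfrak m}\in\mathbb Z[t_1,t_2]$, where $\Lambda(P)$ is the finite set of exponents $\mathfrak m$ with $c_{\mathfrak m}\neq 0$, and suppose that $P$ really depends on $t_1$, that is, $\deg_{t_1}P\ge 1$. Let $N_0$ be the largest positive integer $t_2$ such that $P(t_1,t_2)=0$ for all $t_1\in\mathbb Z$ ($N_0=0$ if there is none), let $p$ be the least non-negative integer with $N_0\le 2^p$, and put $$C(P):=\max\Big\{10\sum_{\mathfrak m,\mathfrak n\in\Lambda(P)}\Big|\frac{c_{\mathfrak m}}{c_{\mathfrak n}}\Big|,\ 2^p\Big\}.$$ For integers $q\ge 1$, $a$ and $t_2$ let $$S^{t_2}\Big(\frac aq\Big)=\frac1q\sum_{t_1=1}^q e^{2\pi i\frac aq P(t_1,t_2)}.$$ Then there are $\delta>0$ and $C>0$, depending only on $P$, such that for every non-negative integer $j_2$ with $2^{j_2}\ge C(P)$, every integer $q\ge 1$ and every integer $a$ with $\gcd(a,q)=1$, $$\frac1{2^{j_2}}\sum_{t_2\in\mathbb Z,\ 2^{j_2-1}\le|t_2|\le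 2^{j_2}}\Big|S^{t_2}\Big(\frac aq\Big)\Big|\le C\,q^{-\delta}.$$ -/

import Mathlib

open scoped BigOperators

noncomputable section

namespace GaussAverage

/-- The value `P(t₁, t₂)` of an integer polynomial in two variables
(variable `0` is `t₁`, variable `1` is `t₂`). -/
def value (P : MvPolynomial (Fin 2) ℤ) (t₁ t₂ : ℤ) : ℤ :=
  MvPolynomial.eval ![t₁, t₂] P

/-- The Gauss sum `S^{t₂}(a/q) = q⁻¹ ∑_{t₁ = 1}^q exp (2 π i (a/q) P(t₁, t₂))`. -/
def gaussSum (P : MvPolynomial (Fin 2) ℤ) (a : ℤ) (q : ℕ) (t₂ : ℤ) : ℂ :=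
  (1 / (q : ℂ)) * ∑ t₁ ∈ Finset.Icc 1 q,
    Complex.exp (2 * (Real.pi : ℂ) * Complex.I * ((a : ℂ) / (q : ℂ)) *
      ((value P (t₁ : ℤ) t₂ : ℤ) : ℂ))

/-- The largest positive integer `t₂` such that `P(t₁, t₂) = 0` for all `t₁`
(and `0` if there is none; for `P ≠ 0` the set is finite). -/
def lastZeroFibre (P : MvPolynomial (Fin 2) ℤ) : ℕ :=
  sSup {t₂ : ℕ | 1 ≤ t₂ ∧ ∀ t₁ : ℤ, value P t₁ (t₂ : ℤ) = 0}

/-- The threshold `C(P) = max {10 ∑_{m, n ∈ Λ(P)} |c_m / c_n|, 2 ^ p}`, where `Λ(P)` is the set of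
exponents of `P` and `p` is the least natural number with `lastZeroFibre P ≤ 2 ^ p`. -/
def threshold (P : MvPolynomial (Fin 2) ℤ) : ℝ :=
  max (10 * ∑ m ∈ P.support, ∑ n ∈ P.support,
        |((MvPolynomial.coeff m P : ℤ) : ℝ) / ((MvPolynomial.coeff n P : ℤ) : ℝ)|)
    ((2 : ℝ) ^ Nat.clog 2 (lastZeroFibre P))

/-- The integers `t` (of both signs) with `t ∼ 2 ^ j`, that is, `2 ^ (j - 1) ≤ |t| ≤ 2 ^ j`. -/
def dyadic (j : ℕ) : Finset ℤ :=
  (Finset.Icc (-(2 : ℤ) ^ j) ((2 : ℤ) ^ j)).filter fun t => (2 : ℤ) ^ j ≤ 2 * |t|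

end GaussAverage

end

/-! Let `p(t₂)` be the coefficient of the top power `t₁ ^ (d + 1)` in `P`. Weyl differencing modulo
`q` (`expSumAvg_pow_le`) bounds the `2 ^ d`-th power of the normalized sum at `t₂` by `τ(q) ^ d *
gcd(q, a p(t₂)) / q` up to a constant. With `τ(q) ≪ q ^ ε` this saves a power of `q` whenever the
gcd is at most `√q`.

For the other `t₂` the trivial bound `1` is used, so they must be rare. There a divisor `r > √q` of
`q` divides `p(t₂)`, which is nonzero because the threshold exceeds Cauchy's root bound. A
Vandermonde determinant shows that `r ∣ p(t)` has at most `deg p` solutions in an interval whose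
length is a small power of `q`; summing over the cells of `[-N, N]` and over `r` gives `O(N q ^
(-δ))` exceptions (`Polynomial.exists_card_large_common_divisor_le`). -/

open Finset in
/-- The divisor bound `τ(n) ≪_ε n ^ ε`. -/
theorem exists_card_divisors_le_rpow {ε : ℝ} (hε : 0 < ε) :
    ∃ C : ℝ, 1 ≤ C ∧ ∀ n : ℕ, n ≠ 0 → (#n.divisors : ℝ) ≤ C * (n : ℝ) ^ ε := by
  have hlog : 0 < Real.log 2 := Real.log_pos (by norm_num)
  set M : ℝ := 1 + 1 / (ε * Real.log 2) with hM
  have hM1 : 1 ≤ M := by rw [hM]; simp; positivity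
  -- Primes `p ≥ B` satisfy `p ^ ε ≥ 2`, so `a + 1 ≤ 2 ^ a ≤ p ^ (a ε)` at no cost; each of the at
  -- most `B` smaller primes costs a factor `M`.
  set B : ℕ := ⌈(2 : ℝ) ^ (1 / ε)⌉₊ with hB
  refine ⟨M ^ B, one_le_pow₀ hM1, fun n hn ↦ ?_⟩
  have hfactor : ∀ p ∈ n.primeFactors, ((n.factorization p + 1 : ℕ) : ℝ) ≤
      (if p < B then M else 1) * ((p : ℝ) ^ n.factorization p) ^ ε := by
    intro p hp
    set a := n.factorization p
    have hp2 : (2 : ℝ) ≤ p := by exact_mod_cast (Nat.prime_of_mem_primeFactors hp).two_le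
    rw [← Real.rpow_natCast, ← Real.rpow_mul (by positivity)]
    split_ifs with h
    · have h1 : 1 + a * ε * Real.log 2 ≤ (p : ℝ) ^ ((a : ℝ) * ε) := by
        calc 1 + a * ε * Real.log 2 ≤ Real.exp (a * ε * Real.log 2) := by
              linarith [Real.add_one_le_exp (a * ε * Real.log 2)]
          _ = (2 : ℝ) ^ ((a : ℝ) * ε) := by
              rw [Real.rpow_def_of_pos (by norm_num)]; ring_nf
          _ ≤ _ := Real.rpow_le_rpow (by norm_num) hp2 (by positivity)
      calc ((a + 1 : ℕ) : ℝ) ≤ M * (1 + a * ε * Real.log 2) := by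
            have : M * (1 + a * ε * Real.log 2) =
                a + 1 + (1 / (ε * Real.log 2) + a * ε * Real.log 2) := by
              rw [hM]; field_simp; ring
            rw [this]; push_cast
            have : 0 ≤ 1 / (ε * Real.log 2) + a * ε * Real.log 2 := by positivity
            linarith
        _ ≤ _ := by gcongr
    · have h2 : (2 : ℝ) ≤ (p : ℝ) ^ ε := by
        have h3 : (2 : ℝ) ^ (1 / ε) ≤ p := (Nat.le_ceil _).trans (by exact_mod_cast not_lt.1 h)
        calc (2 : ℝ) = ((2 : ℝ) ^ (1 / ε)) ^ ε := by
              rw [← Real.rpow_mul (by norm_num), one_div_mul_cancel hε.ne', Real.rpow_one]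
          _ ≤ _ := Real.rpow_le_rpow (by positivity) h3 hε.le
      rw [one_mul, mul_comm, Real.rpow_mul (by positivity), Real.rpow_natCast]
      calc ((a + 1 : ℕ) : ℝ) ≤ (2 : ℝ) ^ a := by exact_mod_cast Nat.lt_two_pow_self
        _ ≤ _ := by gcongr
  rw [Nat.card_divisors hn, Nat.cast_prod]
  calc ∏ p ∈ n.primeFactors, ((n.factorization p + 1 : ℕ) : ℝ)
      ≤ ∏ p ∈ n.primeFactors, (if p < B then M else 1) * ((p : ℝ) ^ n.factorization p) ^ ε :=
        prod_le_prod (fun _ _ ↦ by positivity) hfactor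
    _ = M ^ #{p ∈ n.primeFactors | p < B} * (n : ℝ) ^ ε := by
        rw [prod_mul_distrib, ← prod_filter, prod_const,
          Real.finsetProd_rpow _ _ (fun _ _ ↦ by positivity)]
        congr 2
        conv_rhs => rw [← Nat.prod_factorization_pow_eq_self hn]
        rw [Finsupp.prod, Nat.support_factorization]
        push_cast
        rfl
    _ ≤ M ^ B * (n : ℝ) ^ ε := by
        gcongr
        calc #{p ∈ n.primeFactors | p < B} ≤ #(range B) :=
              card_le_card fun p hp ↦ mem_range.2 (mem_filter.1 hp).2
          _ = B := card_range B

/-! ### Residue sums and averages of gcds -/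

open Finset in
theorem ZMod.sum_val {M : Type*} [AddCommMonoid M] (q : ℕ) [NeZero q] (f : ℕ → M) :
    ∑ h : ZMod q, f h.val = ∑ k ∈ range q, f k := by
  refine sum_nbij ZMod.val (fun h _ ↦ mem_range.2 (ZMod.val_lt h))
    (fun x _ y _ hxy ↦ ZMod.val_injective q hxy) (fun k hk ↦ ?_) (fun _ _ ↦ rfl)
  exact ⟨k, by simp, ZMod.val_cast_of_lt (by simpa using hk)⟩

open Finset in
theorem ZMod.sum_Icc_natCast {M : Type*} [AddCommMonoid M] (q : ℕ) [NeZero q]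
    (g : ZMod q → M) : ∑ t ∈ Icc 1 q, g (t : ZMod q) = ∑ x, g x := by
  rw [← Equiv.sum_comp (Equiv.addRight (1 : ZMod q)) g]
  have := ZMod.sum_val q fun k ↦ g ((k : ZMod q) + 1)
  simp only [ZMod.natCast_zmod_val] at this
  simp only [Equiv.coe_addRight, this]
  rw [range_eq_Ico]
  simpa [← Finset.Ico_add_one_right_eq_Icc] using
    (sum_Ico_add' (fun t : ℕ ↦ g (t : ZMod q)) 0 q 1).symm

-- For each `d ∣ q`, exactly `φ(q / d)` residues have gcd `d`, contributing at most `q` together.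
open Finset in
theorem sum_gcd_le_mul_card_divisors (q : ℕ) [NeZero q] :
    ∑ h : ZMod q, Nat.gcd q h.val ≤ q * #q.divisors := by
  have hq : q ≠ 0 := NeZero.ne q
  rw [ZMod.sum_val q (Nat.gcd q), ← sum_fiberwise_of_maps_to (t := q.divisors) (g := fun k ↦ Nat.gcd q k)
    (fun k _ ↦ Nat.mem_divisors.2 ⟨Nat.gcd_dvd_left q k, hq⟩)]
  calc _ ≤ ∑ d ∈ q.divisors, q := sum_le_sum fun d hd ↦ ?_
    _ = _ := by rw [sum_const, smul_eq_mul, mul_comm]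
  have hdq := Nat.dvd_of_mem_divisors hd
  rw [sum_congr rfl (g := fun _ ↦ d) (fun k hk ↦ (mem_filter.1 hk).2), sum_const, smul_eq_mul,
    ← Nat.totient_div_of_dvd hdq]
  exact (Nat.mul_le_mul_right d (Nat.totient_le _)).trans (Nat.div_mul_cancel hdq).le

theorem ZMod.gcd_val_mul_dvd (q : ℕ) [NeZero q] (x y : ZMod q) :
    Nat.gcd q (x * y).val ∣ Nat.gcd q x.val * Nat.gcd q y.val := by
  have : Nat.gcd q (x * y).val = Nat.gcd q (x.val * y.val) := by
    rw [ZMod.val_mul, Nat.gcd_comm, ← Nat.gcd_rec]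
  rw [this]
  exact Nat.gcd_mul_right_dvd_mul_gcd _ _ _

-- Averages the gcds of the leading coefficients `n b h` that differencing produces; `gcd(q, ·)` is
-- submultiplicative.
open Finset in
theorem sum_gcd_natCast_mul_mul_le (q : ℕ) [NeZero q] {n : ℕ} (hn : n ≠ 0) (b : ZMod q) :
    ∑ h : ZMod q, Nat.gcd q ((n : ZMod q) * b * h).val ≤
      n * Nat.gcd q b.val * (q * #q.divisors) := by
  refine le_trans ?_ (Nat.mul_le_mul_left _ (sum_gcd_le_mul_card_divisors q))
  rw [mul_sum]
  have hpos (x : ZMod q) : 0 < Nat.gcd q x.val := Nat.gcd_pos_of_pos_left _ (NeZero.pos q)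
  refine sum_le_sum fun h _ ↦ ?_
  refine (Nat.le_of_dvd (Nat.mul_pos (hpos _) (hpos _)) (ZMod.gcd_val_mul_dvd q _ h)).trans ?_
  refine Nat.mul_le_mul_right _ ?_
  refine (Nat.le_of_dvd (Nat.mul_pos (hpos _) (hpos _)) (ZMod.gcd_val_mul_dvd q _ b)).trans ?_
  refine Nat.mul_le_mul_right _ (Nat.le_of_dvd (Nat.pos_of_ne_zero hn) ?_)
  rw [ZMod.val_natCast, Nat.gcd_comm, ← Nat.gcd_rec]
  exact Nat.gcd_dvd_right _ _

/-! ### Weyl differencing for complete sums -/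

open Polynomial in
theorem Polynomial.coeff_taylor_sub_self {R : Type*} [CommRing R] {F : R[X]} {d : ℕ}
    (hF : F.natDegree ≤ d + 1) (h : R) :
    (taylor h F - F).coeff d = ((d + 1 : ℕ) : R) * F.coeff (d + 1) * h := by
  have h1 : (hasseDeriv d F).natDegree ≤ 1 :=
    (natDegree_hasseDeriv_le F d).trans (by omega)
  rw [coeff_sub, taylor_coeff, eval_eq_sum_range' (Nat.lt_succ_of_le h1)]
  simp [Finset.sum_range_succ, hasseDeriv_coeff, add_comm]

open Polynomial in
theorem Polynomial.natDegree_taylor_sub_self_le {R : Type*} [CommRing R] {F : R[X]} {d : ℕ}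
    (hF : F.natDegree ≤ d + 1) (h : R) : (taylor h F - F).natDegree ≤ d := by
  rw [natDegree_le_iff_coeff_eq_zero]
  intro n hn
  rw [coeff_taylor_sub_self (by omega), coeff_eq_zero_of_natDegree_lt (by omega)]
  simp

-- Expand the square as a double sum and substitute `y = x + h`.
open Finset in
theorem norm_sum_sq_le_sum_norm_sum_shift {G : Type*} [AddCommGroup G] [Fintype G] (f : G → ℂ) :
    ‖∑ x, f x‖ ^ 2 ≤ ∑ h, ‖∑ x, f (x + h) * (starRingEnd ℂ) (f x)‖ := by
  have : ((‖∑ x, f x‖ ^ 2 : ℝ) : ℂ) = ∑ h, ∑ x, f (x + h) * (starRingEnd ℂ) (f x) := by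
    rw [Complex.ofReal_pow, ← Complex.mul_conj', map_sum, sum_comm, mul_comm, sum_mul]
    refine sum_congr rfl fun x _ ↦ ?_
    rw [mul_comm, ← sum_mul]
    congr 1
    exact (Equiv.sum_comp (Equiv.addLeft x) f).symm
  calc ‖∑ x, f x‖ ^ 2 = ‖((‖∑ x, f x‖ ^ 2 : ℝ) : ℂ)‖ := by simp
    _ ≤ _ := by rw [this]; exact norm_sum_le _ _

open Polynomial in
/-- The normalized absolute value of the complete exponential sum of `F` modulo `q`. -/
noncomputable def expSumAvg {q : ℕ} [NeZero q] (F : (ZMod q)[X]) : ℝ :=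
  (q : ℝ)⁻¹ * ‖∑ x, ZMod.stdAddChar (F.eval x)‖

open Polynomial in
theorem expSumAvg_nonneg {q : ℕ} [NeZero q] (F : (ZMod q)[X]) : 0 ≤ expSumAvg F := by
  unfold expSumAvg; positivity

open Polynomial in
theorem expSumAvg_le_one {q : ℕ} [NeZero q] (F : (ZMod q)[X]) : expSumAvg F ≤ 1 := by
  have hq : (0 : ℝ) < q := by exact_mod_cast NeZero.pos q
  rw [expSumAvg, inv_mul_le_iff₀ hq, mul_one]
  refine (norm_sum_le _ _).trans ?_
  simp [ZMod.card]

open Polynomial in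
/-- Weyl differencing. -/
theorem expSumAvg_sq_le {q : ℕ} [NeZero q] (F : (ZMod q)[X]) :
    expSumAvg F ^ 2 ≤ ∑ h : ZMod q, (q : ℝ)⁻¹ * expSumAvg (taylor h F - F) := by
  have h1 := norm_sum_sq_le_sum_norm_sum_shift fun x : ZMod q ↦ ZMod.stdAddChar (F.eval x)
  have h2 (h x : ZMod q) : ZMod.stdAddChar (F.eval (x + h)) *
      (starRingEnd ℂ) (ZMod.stdAddChar (F.eval x)) =
        ZMod.stdAddChar ((taylor h F - F).eval x) := by
    rw [← AddChar.map_neg_eq_conj, ← AddChar.map_add_eq_mul, eval_sub, taylor_eval, sub_eq_add_neg]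
  simp only [h2] at h1
  simp only [expSumAvg, ← mul_assoc, ← Finset.mul_sum]
  rw [mul_pow, pow_two (q : ℝ)⁻¹]
  gcongr

open Polynomial Finset Nat in
/-- Weyl's bound for complete exponential sums. -/
theorem expSumAvg_pow_le {q : ℕ} [NeZero q] (d : ℕ) (F : (ZMod q)[X])
    (hF : F.natDegree ≤ d + 1) :
    expSumAvg F ^ 2 ^ d ≤
      (d + 1)! * (#q.divisors : ℝ) ^ d * (Nat.gcd q (F.coeff (d + 1)).val / q) := by
  have hq : (0 : ℝ) < q := by exact_mod_cast NeZero.pos q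
  induction d generalizing F with
  | zero =>
    -- If the linear coefficient vanishes, the gcd is `q` and the bound is trivial; otherwise
    -- orthogonality kills the sum.
    by_cases hb : F.coeff 1 = 0
    · simpa [hb, hq.ne'] using expSumAvg_le_one F
    · have hlin (x : ZMod q) : ZMod.stdAddChar (F.eval x) =
          ZMod.stdAddChar (F.coeff 0) * ZMod.stdAddChar (x * F.coeff 1) := by
        rw [← AddChar.map_add_eq_mul, eval_eq_sum_range' (Nat.lt_succ_of_le hF)]
        simp [sum_range_succ, mul_comm]
      have : expSumAvg F = 0 := by
        simp [expSumAvg, hlin, ← mul_sum,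
          AddChar.sum_mulShift _ (ZMod.isPrimitive_stdAddChar q), hb]
      rw [this, zero_pow (by simp)]
      positivity
  | succ d ih =>
    have hmean := Real.pow_arith_mean_le_arith_mean_pow univ (fun _ : ZMod q ↦ (q : ℝ)⁻¹)
      (fun h ↦ expSumAvg (taylor h F - F)) (fun _ _ ↦ by positivity)
      (by simp [ZMod.card, hq.ne']) (fun _ _ ↦ expSumAvg_nonneg _) (2 ^ d)
    have hsum : (∑ h : ZMod q,
        (Nat.gcd q (((d + 1 + 1 : ℕ) : ZMod q) * F.coeff (d + 1 + 1) * h).val : ℝ)) ≤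
          (d + 1 + 1 : ℕ) * Nat.gcd q (F.coeff (d + 1 + 1)).val * (q * #q.divisors) := by
      exact_mod_cast sum_gcd_natCast_mul_mul_le q (Nat.succ_ne_zero (d + 1)) (F.coeff (d + 1 + 1))
    calc expSumAvg F ^ 2 ^ (d + 1) = (expSumAvg F ^ 2) ^ 2 ^ d := by
          rw [← pow_mul, pow_succ, mul_comm]
      _ ≤ (∑ h : ZMod q, (q : ℝ)⁻¹ * expSumAvg (taylor h F - F)) ^ 2 ^ d := by
          gcongr
          exact expSumAvg_sq_le F
      _ ≤ ∑ h : ZMod q, (q : ℝ)⁻¹ * expSumAvg (taylor h F - F) ^ 2 ^ d := hmean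
      _ ≤ ∑ h : ZMod q, (q : ℝ)⁻¹ * ((d + 1)! * (#q.divisors : ℝ) ^ d *
            (Nat.gcd q (((d + 1 + 1 : ℕ) : ZMod q) * F.coeff (d + 1 + 1) * h).val / q)) := by
          gcongr with h
          rw [← coeff_taylor_sub_self hF]
          exact ih _ (natDegree_taylor_sub_self_le hF h)
      _ = (q : ℝ)⁻¹ * ((d + 1)! * (#q.divisors : ℝ) ^ d * ((∑ h : ZMod q,
            (Nat.gcd q (((d + 1 + 1 : ℕ) : ZMod q) * F.coeff (d + 1 + 1) * h).val : ℝ)) / q)) := by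
          rw [← mul_sum, ← mul_sum, sum_div]
      _ ≤ (q : ℝ)⁻¹ * ((d + 1)! * (#q.divisors : ℝ) ^ d *
            (((d + 1 + 1 : ℕ) * Nat.gcd q (F.coeff (d + 1 + 1)).val * (q * #q.divisors)) / q)) := by
          gcongr
      _ = _ := by
          rw [Nat.factorial_succ (d + 1)]
          push_cast
          field_simp
          ring

/-! ### Polynomial values with a large divisor -/

-- The Vandermonde matrix sends the coefficient vector to the values; applying the adjugate recovers
-- `det` times the coefficients, the last being the leading one.
open Polynomial Matrix in
theorem Polynomial.dvd_det_vandermonde_mul_leadingCoeff (p : ℤ[X]) (r : ℤ)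
    (x : Fin (p.natDegree + 1) → ℤ) (hx : ∀ i, r ∣ p.eval (x i)) :
    r ∣ (vandermonde x).det * p.leadingCoeff := by
  set c : Fin (p.natDegree + 1) → ℤ := fun j ↦ p.coeff j
  have hV (i) : (vandermonde x *ᵥ c) i = p.eval (x i) := by
    rw [eval_eq_sum_range, ← Fin.sum_univ_eq_sum_range (fun j ↦ p.coeff j * x i ^ j)]
    simp [mulVec, dotProduct, vandermonde_apply, c, mul_comm]
  have hdet : (vandermonde x).det * p.leadingCoeff =
      ((vandermonde x).adjugate *ᵥ (vandermonde x *ᵥ c)) (Fin.last _) := by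
    rw [mulVec_mulVec, adjugate_mul, smul_mulVec, one_mulVec]
    simp [c]
  rw [hdet]
  change r ∣ ∑ i, (vandermonde x).adjugate (Fin.last _) i * (vandermonde x *ᵥ c) i
  refine Finset.dvd_sum fun i _ ↦ Dvd.dvd.mul_left ?_ _
  rw [hV]
  exact hx i

open Polynomial Finset in
/-- A polynomial of degree `D` takes values divisible by `r` at no more than `D` points of a
short interval. -/
theorem Polynomial.card_le_natDegree_of_dvd_eval (p : ℤ[X]) (hp : p ≠ 0) {r : ℤ} {H : ℝ}
    (hH : 1 ≤ H) (hr : |(p.leadingCoeff : ℝ)| * H ^ ((p.natDegree + 1) * (p.natDegree + 1)) < r)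
    (s : Finset ℤ) (hs : ∀ x ∈ s, ∀ y ∈ s, |(x : ℝ) - y| ≤ H) (hdvd : ∀ x ∈ s, r ∣ p.eval x) :
    #s ≤ p.natDegree := by
  by_contra! hcard
  obtain ⟨t, hts, ht⟩ := exists_subset_card_eq (Nat.succ_le_of_lt hcard)
  let x : Fin (p.natDegree + 1) → ℤ := fun i ↦ ((t.equivFinOfCardEq ht).symm i : ℤ)
  have hxs (i) : x i ∈ s := hts ((t.equivFinOfCardEq ht).symm i).2
  have hinj : Function.Injective x :=
    Subtype.val_injective.comp (t.equivFinOfCardEq ht).symm.injective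
  have hdet : (Matrix.vandermonde x).det ≠ 0 := Matrix.det_vandermonde_ne_zero_iff.2 hinj
  have hle : r ≤ |(Matrix.vandermonde x).det * p.leadingCoeff| :=
    Int.le_of_dvd (abs_pos.2 (mul_ne_zero hdet (leadingCoeff_ne_zero.2 hp)))
      ((dvd_abs _ _).2 (p.dvd_det_vandermonde_mul_leadingCoeff r x fun i ↦ hdvd _ (hxs i)))
  have hle' : (r : ℝ) ≤ |((Matrix.vandermonde x).det : ℝ)| * |(p.leadingCoeff : ℝ)| := by
    rw [← abs_mul]; exact_mod_cast hle
  have hbound : |((Matrix.vandermonde x).det : ℝ)| ≤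
      H ^ ((p.natDegree + 1) * (p.natDegree + 1)) := by
    rw [Matrix.det_vandermonde]
    push_cast
    rw [abs_prod]
    calc ∏ i, |∏ j ∈ Ioi i, ((x j : ℝ) - x i)| ≤
          ∏ _i : Fin (p.natDegree + 1), H ^ (p.natDegree + 1) := by
          refine prod_le_prod (fun _ _ ↦ abs_nonneg _) fun i _ ↦ ?_
          rw [abs_prod]
          calc ∏ j ∈ Ioi i, |(x j : ℝ) - x i| ≤ ∏ _j ∈ Ioi i, H :=
                prod_le_prod (fun _ _ ↦ abs_nonneg _) fun j _ ↦ hs _ (hxs j) _ (hxs i)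
            _ = H ^ #(Ioi i) := prod_const _
            _ ≤ _ := pow_le_pow_right₀ hH ((card_le_univ _).trans (by simp))
      _ = _ := by rw [prod_const, card_univ, Fintype.card_fin, pow_mul]
  have := mul_le_mul_of_nonneg_right hbound (abs_nonneg (p.leadingCoeff : ℝ))
  linarith [mul_comm |(p.leadingCoeff : ℝ)| (H ^ ((p.natDegree + 1) * (p.natDegree + 1)))]

-- Cut `[-N, N]` into cells of length `H`, indexed by `⌊t / H⌋`; each contains at most `deg p`
-- solutions.
open Polynomial Finset in
theorem Polynomial.card_filter_dvd_eval_le (p : ℤ[X]) (hp : p ≠ 0) {r : ℤ} {H : ℝ}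
    (hH : 1 ≤ H) (hr : |(p.leadingCoeff : ℝ)| * H ^ ((p.natDegree + 1) * (p.natDegree + 1)) < r)
    {N : ℤ} (hN : 0 ≤ N) :
    (#{t ∈ Icc (-N) N | r ∣ p.eval t} : ℝ) ≤ p.natDegree * (2 * (N / H) + 2) := by
  have hH0 : 0 < H := one_pos.trans_le hH
  set s := {t ∈ Icc (-N) N | r ∣ p.eval t}
  let f : ℤ → ℤ := fun t ↦ ⌊(t : ℝ) / H⌋
  have h1 : #s ≤ p.natDegree * #(s.image f) := by
    refine card_le_mul_card_image s _ fun m _ ↦ ?_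
    refine p.card_le_natDegree_of_dvd_eval hp hH hr _ (fun x hx y hy ↦ ?_) fun x hx ↦ ?_
    · have := (Int.abs_sub_lt_one_of_floor_eq_floor
        ((mem_filter.1 hx).2.trans (mem_filter.1 hy).2.symm)).le
      rwa [← sub_div, abs_div, abs_of_pos hH0, div_le_one hH0] at this
    · exact (mem_filter.1 (mem_filter.1 hx).1).2
  have h2 : s.image f ⊆ Icc ⌊-((N : ℝ) / H)⌋ ⌊(N : ℝ) / H⌋ := by
    intro m hm
    obtain ⟨t, ht, rfl⟩ := mem_image.1 hm
    obtain ⟨ht1, ht2⟩ := mem_Icc.1 (mem_filter.1 ht).1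
    refine mem_Icc.2 ⟨Int.floor_mono ?_, Int.floor_mono ?_⟩
    · rw [← neg_div]
      gcongr
      exact_mod_cast ht1
    · gcongr
  have hNH : 0 ≤ (N : ℝ) / H := by positivity
  have h3 : (#(s.image f) : ℝ) ≤ 2 * (N / H) + 2 := by
    have h4 : (#(s.image f) : ℝ) ≤ #(Icc ⌊-((N : ℝ) / H)⌋ ⌊(N : ℝ) / H⌋) := by
      exact_mod_cast card_le_card h2
    have h5 : ⌊-((N : ℝ) / H)⌋ ≤ ⌊(N : ℝ) / H⌋ := Int.floor_mono (by linarith)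
    have h6 : ((#(Icc ⌊-((N : ℝ) / H)⌋ ⌊(N : ℝ) / H⌋) : ℤ) : ℝ) =
        ⌊(N : ℝ) / H⌋ + 1 - ⌊-((N : ℝ) / H)⌋ := by
      rw [Int.card_Icc, Int.toNat_of_nonneg (by omega)]
      push_cast; ring
    rw [Int.cast_natCast] at h6
    linarith [Int.floor_le ((N : ℝ) / H), Int.lt_floor_add_one (-((N : ℝ) / H))]
  calc (#s : ℝ) ≤ p.natDegree * #(s.image f) := by exact_mod_cast h1
    _ ≤ _ := by gcongr

-- The choice of `ε` makes `τ(q) ^ d` cost at most `q ^ (1/4)` of the saving `q ^ (1/2)`; a `2 ^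
-- d`-th root follows.
open Polynomial Finset in
theorem exists_expSumAvg_le_rpow (d : ℕ) :
    ∃ K : ℝ, 0 < K ∧ ∃ δ : ℝ, 0 < δ ∧ ∀ (q : ℕ) [NeZero q] (F : (ZMod q)[X]),
      F.natDegree ≤ d + 1 → (Nat.gcd q (F.coeff (d + 1)).val : ℝ) ≤ (q : ℝ) ^ (1 / 2 : ℝ) →
        expSumAvg F ≤ K * (q : ℝ) ^ (-δ) := by
  obtain ⟨C, hC1, hC⟩ := exists_card_divisors_le_rpow (ε := 1 / (4 * (d + 1))) (by positivity)
  set A : ℝ := (d + 1).factorial * C ^ d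
  have hA : 1 ≤ A :=
    one_le_mul_of_one_le_of_one_le (by exact_mod_cast Nat.factorial_pos _) (one_le_pow₀ hC1)
  refine ⟨A, by positivity, 1 / (4 * 2 ^ d), by positivity, fun q _ F hF hgcd ↦ ?_⟩
  have hq : (1 : ℝ) ≤ q := by exact_mod_cast NeZero.one_le
  have hq0 : (0 : ℝ) < q := by linarith
  have h1 : expSumAvg F ^ 2 ^ d ≤ A * (q : ℝ) ^ (-(1 / 4) : ℝ) := by
    calc expSumAvg F ^ 2 ^ d ≤
          (d + 1).factorial * (#q.divisors : ℝ) ^ d *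
            (Nat.gcd q (F.coeff (d + 1)).val / q) := expSumAvg_pow_le d F hF
      _ ≤ (d + 1).factorial * (C * (q : ℝ) ^ (1 / (4 * (d + 1)) : ℝ)) ^ d *
            ((q : ℝ) ^ (1 / 2 : ℝ) / q) := by
          gcongr
          exact hC q (NeZero.ne q)
      _ = A * (q : ℝ) ^ ((1 / (4 * (d + 1)) : ℝ) * d + (1 / 2 - 1)) := by
          rw [mul_pow, ← Real.rpow_natCast (_ ^ _), ← Real.rpow_mul hq0.le, Real.rpow_add hq0,
            Real.rpow_sub_one hq0.ne']
          ring
      _ ≤ A * (q : ℝ) ^ (-(1 / 4) : ℝ) := by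
          gcongr
          have : (1 / (4 * (d + 1)) : ℝ) * d ≤ 1 / 4 := by
            rw [one_div_mul_eq_div, div_le_div_iff₀ (by positivity) (by norm_num)]
            linarith
          linarith
  refine le_of_pow_le_pow_left₀ (n := 2 ^ d) (by positivity) (by positivity) (h1.trans ?_)
  rw [mul_pow, ← Real.rpow_natCast (_ ^ _), ← Real.rpow_mul hq0.le]
  have h2 : -(1 / (4 * 2 ^ d) : ℝ) * (2 ^ d : ℕ) = -(1 / 4) := by
    push_cast; field_simp
  rw [h2]
  gcongr
  exact le_self_pow₀ hA (by positivity)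

open Polynomial in
theorem Polynomial.abs_eval_le_sum_abs_coeff_mul_pow (p : ℤ[X]) {t N : ℤ} (hN : 1 ≤ N)
    (ht : |t| ≤ N) :
    |p.eval t| ≤ (∑ i ∈ Finset.range (p.natDegree + 1), |p.coeff i|) * N ^ p.natDegree := by
  rw [eval_eq_sum_range, Finset.sum_mul]
  refine (Finset.abs_sum_le_sum_abs _ _).trans (Finset.sum_le_sum fun i hi ↦ ?_)
  rw [abs_mul, abs_pow]
  gcongr
  calc |t| ^ i ≤ N ^ i := by gcongr
    _ ≤ _ := pow_le_pow_right₀ hN (Nat.lt_succ_iff.1 (Finset.mem_range.1 hi))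

open Polynomial Finset in
/-- Few integers `t` of size at most `N` are such that `p(t)` is nonzero and shares with `q` a
divisor exceeding `√q`. -/
theorem Polynomial.exists_card_large_common_divisor_le (p : ℤ[X]) (hp : p ≠ 0) :
    ∃ K : ℝ, 0 < K ∧ ∃ δ : ℝ, 0 < δ ∧ ∀ (q : ℕ) (N : ℤ), 1 ≤ q → 1 ≤ N → ∀ s : Finset ℤ,
      (∀ t ∈ s, |t| ≤ N ∧ p.eval t ≠ 0 ∧
        ∃ r : ℕ, r ∣ q ∧ (q : ℝ) ^ (1 / 2 : ℝ) < r ∧ (r : ℤ) ∣ p.eval t) →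
      (#s : ℝ) ≤ K * N * (q : ℝ) ^ (-δ) := by
  set D := p.natDegree
  -- With `H = q ^ θ` the determinant is at most `q ^ (1/4)`, leaving `q ^ (1/4)` for the leading
  -- coefficient; hence the separate case `q ≤ c ^ 4`.
  set θ : ℝ := 1 / (4 * ((D + 1) * (D + 1))) with hθdef
  have hθ : 0 < θ := by positivity
  obtain ⟨C, hC1, hC⟩ := exists_card_divisors_le_rpow (ε := θ / 2) (by positivity)
  set c : ℝ := |(p.leadingCoeff : ℝ)|
  set A : ℝ := ((∑ i ∈ range (D + 1), |p.coeff i| : ℤ) : ℝ) + 1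
  have hA0 : (0 : ℝ) ≤ ((∑ i ∈ range (D + 1), |p.coeff i| : ℤ) : ℝ) := by
    exact_mod_cast sum_nonneg fun _ _ ↦ abs_nonneg _
  have hA1 : 1 ≤ A := by linarith
  have hc0 : 0 ≤ c := abs_nonneg _
  refine ⟨3 * (c ^ 4 + 1) ^ (θ / 2) + C * (D * (2 + 2 * A)), by positivity, θ / 2, by positivity,
    fun q N hq hN s hs ↦ ?_⟩
  have hq1 : (1 : ℝ) ≤ q := by exact_mod_cast hq
  have hq0 : (0 : ℝ) < q := by linarith
  have hN1 : (1 : ℝ) ≤ N := by exact_mod_cast hN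
  have hsub : s ⊆ Icc (-N) N := fun t ht ↦ mem_Icc.2 (abs_le.1 (hs t ht).1)
  rcases s.eq_empty_or_nonempty with rfl | ⟨t₀, ht₀⟩
  · simp only [card_empty, Nat.cast_zero]; positivity
  rcases le_or_gt (q : ℝ) (c ^ 4) with hqc | hqc
  · have hcard : (#s : ℝ) ≤ 3 * N := by
      have h1 : (#s : ℤ) ≤ #(Icc (-N) N) := by exact_mod_cast card_le_card hsub
      rw [Int.card_Icc, Int.toNat_of_nonneg (by omega)] at h1
      have h2 : (#s : ℤ) ≤ 3 * N := by omega
      exact_mod_cast h2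
    have hone : 1 ≤ (c ^ 4 + 1) ^ (θ / 2) * (q : ℝ) ^ (-(θ / 2)) := by
      rw [Real.rpow_neg hq0.le, ← div_eq_mul_inv, one_le_div (by positivity)]
      exact Real.rpow_le_rpow hq0.le (by linarith) (by positivity)
    calc (#s : ℝ) ≤ 3 * N * ((c ^ 4 + 1) ^ (θ / 2) * (q : ℝ) ^ (-(θ / 2))) :=
          hcard.trans (le_mul_of_one_le_right (by positivity) hone)
      _ = 3 * (c ^ 4 + 1) ^ (θ / 2) * N * (q : ℝ) ^ (-(θ / 2)) := by ring
      _ ≤ _ := by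
          gcongr
          exact le_add_of_nonneg_right (by positivity)
  · set H : ℝ := (q : ℝ) ^ θ
    have hH : 1 ≤ H := Real.one_le_rpow hq1 hθ.le
    have hHpow : c * H ^ ((D + 1) * (D + 1)) ≤ (q : ℝ) ^ (1 / 2 : ℝ) := by
      have h1 : H ^ ((D + 1) * (D + 1)) = (q : ℝ) ^ (1 / 4 : ℝ) := by
        rw [← Real.rpow_natCast, ← Real.rpow_mul hq0.le]
        congr 1
        rw [hθdef]; push_cast; field_simp
      have h2 : c ≤ (q : ℝ) ^ (1 / 4 : ℝ) := by
        calc c = (c ^ 4) ^ (1 / 4 : ℝ) := by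
              rw [← Real.rpow_natCast, ← Real.rpow_mul hc0]; norm_num
          _ ≤ _ := Real.rpow_le_rpow (by positivity) hqc.le (by norm_num)
      calc c * H ^ ((D + 1) * (D + 1)) ≤ (q : ℝ) ^ (1 / 4 : ℝ) * (q : ℝ) ^ (1 / 4 : ℝ) := by
            rw [h1]; gcongr
        _ = _ := by rw [← Real.rpow_add hq0]; norm_num
    -- One exceptional `t₀` already forces `√q < r ≤ |p(t₀)| ≪ N ^ D`, so the `+ 2` in the cell
    -- count is absorbed into `N / H`.
    have hHN : H ≤ A * N := by
      obtain ⟨ht, hne, r, -, hr, hdvd⟩ := hs t₀ ht₀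
      have h1 : (r : ℤ) ≤ |p.eval t₀| := Int.le_of_dvd (abs_pos.2 hne) ((dvd_abs _ _).2 hdvd)
      have h2 : (r : ℝ) ≤ ((∑ i ∈ range (D + 1), |p.coeff i| : ℤ) : ℝ) * (N : ℝ) ^ D := by
        exact_mod_cast h1.trans (p.abs_eval_le_sum_abs_coeff_mul_pow hN ht)
      have h3 : (q : ℝ) ^ (1 / 2 : ℝ) ≤ (A * N) ^ (D + 1) := by
        calc (q : ℝ) ^ (1 / 2 : ℝ) ≤ A * (N : ℝ) ^ D := hr.le.trans (h2.trans (by gcongr; linarith))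
          _ ≤ A ^ (D + 1) * (N : ℝ) ^ (D + 1) := by
              gcongr
              · exact le_self_pow₀ hA1 (by omega)
              · omega
          _ = _ := (mul_pow _ _ _).symm
      calc H = ((q : ℝ) ^ (1 / 2 : ℝ)) ^ (2 * θ) := by
            rw [← Real.rpow_mul hq0.le, ← mul_assoc, one_div_mul_cancel two_ne_zero, one_mul]
        _ ≤ ((A * N) ^ (D + 1)) ^ (2 * θ) := by gcongr
        _ = (A * N) ^ ((D + 1 : ℕ) * (2 * θ)) := by
            rw [← Real.rpow_natCast, ← Real.rpow_mul (by positivity)]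
        _ ≤ (A * N) ^ (1 : ℝ) := by
            refine Real.rpow_le_rpow_of_exponent_le
              (one_le_mul_of_one_le_of_one_le hA1 hN1) ?_
            rw [hθdef]
            push_cast
            have : ((D : ℝ) + 1) * (2 * (1 / (4 * ((D + 1) * (D + 1))))) = 1 / (2 * (D + 1)) := by
              field_simp; norm_num
            rw [this, div_le_one (by positivity)]
            have : (0 : ℝ) ≤ D := by positivity
            linarith
        _ = _ := Real.rpow_one _
    set R := {r ∈ q.divisors | (q : ℝ) ^ (1 / 2 : ℝ) < ((r : ℕ) : ℝ)}
    have hcover : s ⊆ R.biUnion fun r ↦ {t ∈ Icc (-N) N | (r : ℤ) ∣ p.eval t} := by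
      intro t ht
      obtain ⟨-, -, r, hrq, hr, hdvd⟩ := hs t ht
      simp only [mem_biUnion, R, mem_filter, Nat.mem_divisors]
      exact ⟨r, ⟨⟨hrq, by omega⟩, hr⟩, hsub ht, hdvd⟩
    have hcount : ∀ r ∈ R,
        (#{t ∈ Icc (-N) N | (r : ℤ) ∣ p.eval t} : ℝ) ≤ D * (2 * (N / H) + 2) := fun r hr ↦
      p.card_filter_dvd_eval_le hp hH
        (by simpa using hHpow.trans_lt (mem_filter.1 hr).2) (by omega)
    have hH0 : 0 < H := by linarith
    calc (#s : ℝ) ≤ ∑ r ∈ R,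
          (#{t ∈ Icc (-N) N | (r : ℤ) ∣ p.eval t} : ℝ) := by
          exact_mod_cast (card_le_card hcover).trans card_biUnion_le
      _ ≤ ∑ _r ∈ R, (D * (2 * (N / H) + 2) : ℝ) :=
          sum_le_sum hcount
      _ ≤ #q.divisors * (D * (2 * (N / H) + 2)) := by
          rw [sum_const, nsmul_eq_mul]
          gcongr
          exact filter_subset _ _
      _ ≤ (C * (q : ℝ) ^ (θ / 2)) * (D * ((2 + 2 * A) * (N / H))) := by
          gcongr
          · exact hC q (by omega)
          · have : 1 ≤ A * (N / H) := by
              rw [← mul_div_assoc, one_le_div hH0]; exact hHN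
            linarith
      _ = C * (D * (2 + 2 * A)) * N * (q : ℝ) ^ (-(θ / 2)) := by
          have : (q : ℝ) ^ (-(θ / 2)) = (q : ℝ) ^ (θ / 2) / H := by
            rw [← Real.rpow_sub hq0]; congr 1; ring
          rw [this]; ring
      _ ≤ _ := by
          gcongr
          exact le_add_of_nonneg_left (by positivity)

/-! ### Fibres of `P` and the threshold -/

namespace GaussAverage

open Polynomial in
/-- The coefficient of `t₁ ^ k` in `P(t₁, t₂)`, a polynomial in `t₂`. -/
noncomputable def fibreCoeff (P : MvPolynomial (Fin 2) ℤ) (k : ℕ) : ℤ[X] :=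
  ∑ m ∈ P.support with m 0 = k, monomial (m 1) (P.coeff m)

open Polynomial in
/-- The polynomial `P(·, t)`. -/
noncomputable def fibre (P : MvPolynomial (Fin 2) ℤ) (t : ℤ) : ℤ[X] :=
  ∑ m ∈ P.support, monomial (m 0) (P.coeff m * t ^ m 1)

theorem eval_fibre (P : MvPolynomial (Fin 2) ℤ) (s t : ℤ) :
    (fibre P t).eval s = value P s t := by
  simp [fibre, value, MvPolynomial.eval_eq', Polynomial.eval_finsetSum, mul_assoc,
    mul_comm (s ^ _)]

theorem natDegree_fibre_le (P : MvPolynomial (Fin 2) ℤ) (t : ℤ) :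
    (fibre P t).natDegree ≤ P.degreeOf 0 :=
  Polynomial.natDegree_sum_le_of_forall_le _ _ fun _ hm ↦
    (Polynomial.natDegree_monomial_le _).trans (MvPolynomial.monomial_le_degreeOf 0 hm)

theorem coeff_fibre (P : MvPolynomial (Fin 2) ℤ) (t : ℤ) (k : ℕ) :
    (fibre P t).coeff k = (fibreCoeff P k).eval t := by
  simp [fibre, fibreCoeff, Polynomial.coeff_monomial, Polynomial.eval_finsetSum,
    ← Finset.sum_filter]

theorem coeff_fibreCoeff (P : MvPolynomial (Fin 2) ℤ) (m : Fin 2 →₀ ℕ) :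
    (fibreCoeff P (m 0)).coeff (m 1) = P.coeff m := by
  simp only [fibreCoeff, Polynomial.finsetSum_coeff, Polynomial.coeff_monomial]
  rw [Finset.sum_filter, Finset.sum_eq_single m]
  · simp
  · intro n _ hn
    split_ifs with h0 h1
    · exact absurd (Finsupp.ext fun i ↦ by fin_cases i <;> assumption) hn
    all_goals rfl
  · simp +contextual

theorem exists_coeff_fibreCoeff_eq (P : MvPolynomial (Fin 2) ℤ) (k i : ℕ) :
    ∃ m, (fibreCoeff P k).coeff i = P.coeff m :=
  ⟨Finsupp.equivFunOnFinite.symm ![k, i],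
    by simpa using coeff_fibreCoeff P (Finsupp.equivFunOnFinite.symm ![k, i])⟩

theorem fibreCoeff_degreeOf_ne_zero {P : MvPolynomial (Fin 2) ℤ} (hP : 0 < P.degreeOf 0) :
    fibreCoeff P (P.degreeOf 0) ≠ 0 := by
  have hne : P.support.Nonempty := by
    rw [Finset.nonempty_iff_ne_empty, Ne, MvPolynomial.support_eq_empty]
    rintro rfl
    simp at hP
  obtain ⟨m, hm, hmax⟩ := Finset.exists_mem_eq_sup P.support hne fun m ↦ m 0
  rw [MvPolynomial.degreeOf_eq_sup, hmax]
  intro h0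
  have := coeff_fibreCoeff P m
  rw [h0, Polynomial.coeff_zero] at this
  exact MvPolynomial.mem_support_iff.1 hm this.symm

-- With `Q` the double sum of ratios, Cauchy's bound puts every root below `Q + 1 ≤ 2 Q`, whereas
-- the threshold gives `|t| ≥ 5 Q`.
open Finset in
theorem eval_fibreCoeff_ne_zero {P : MvPolynomial (Fin 2) ℤ} {k : ℕ} (hk : fibreCoeff P k ≠ 0)
    {t : ℤ} (ht : threshold P ≤ 2 * |(t : ℝ)|) : (fibreCoeff P k).eval t ≠ 0 := by
  intro hroot
  set p := fibreCoeff P k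
  let Q : ℝ := ∑ m ∈ P.support, ∑ n ∈ P.support,
    |((P.coeff m : ℤ) : ℝ) / ((P.coeff n : ℤ) : ℝ)|
  have hterm (m n) : |((P.coeff m : ℤ) : ℝ) / ((P.coeff n : ℤ) : ℝ)| ≤ Q := by
    by_cases hm : m ∈ P.support
    · by_cases hn : n ∈ P.support
      · refine (single_le_sum (f := fun n ↦ |((P.coeff m : ℤ) : ℝ) / ((P.coeff n : ℤ) : ℝ)|)
          (fun _ _ ↦ abs_nonneg _) hn).trans ?_
        exact single_le_sum (f := fun m ↦ ∑ n ∈ P.support,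
          |((P.coeff m : ℤ) : ℝ) / ((P.coeff n : ℤ) : ℝ)|)
          (fun _ _ ↦ sum_nonneg fun _ _ ↦ abs_nonneg _) hm
      -- Off the support the ratio is `0`, using `x / 0 = 0`.
      · rw [MvPolynomial.notMem_support_iff.1 hn]
        simp only [Int.cast_zero, div_zero, abs_zero]
        positivity
    · rw [MvPolynomial.notMem_support_iff.1 hm]
      simp only [Int.cast_zero, zero_div, abs_zero]
      positivity
  have hlc : (p.leadingCoeff : ℝ) ≠ 0 := by exact_mod_cast Polynomial.leadingCoeff_ne_zero.2 hk
  have hratio (i : ℕ) : |(p.coeff i : ℝ)| / |(p.leadingCoeff : ℝ)| ≤ Q := by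
    obtain ⟨m, hm⟩ := exists_coeff_fibreCoeff_eq P k i
    obtain ⟨n, hn⟩ := exists_coeff_fibreCoeff_eq P k p.natDegree
    rw [Polynomial.leadingCoeff, hm, hn, ← abs_div]
    exact hterm m n
  have hQ1 : 1 ≤ Q := by
    simpa [hlc] using hratio p.natDegree
  have hinj : Function.Injective (Int.castRingHom ℝ) := Int.cast_injective
  set pR := p.map (Int.castRingHom ℝ)
  have hpR : pR ≠ 0 := (Polynomial.map_ne_zero_iff hinj).2 hk
  have hrootR : pR.IsRoot (t : ℝ) := by
    have := Polynomial.eval_intCast_map (Int.castRingHom ℝ) p t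
    rwa [Int.cast_id, hroot, map_zero] at this
  have hlt : |(t : ℝ)| < pR.cauchyBound := by
    exact NNReal.coe_lt_coe.2 (Polynomial.IsRoot.norm_lt_cauchyBound hpR hrootR)
  have hle : (pR.cauchyBound : ℝ) ≤ Q + 1 := by
    rw [Polynomial.cauchyBound]
    push_cast
    gcongr
    rw [div_le_iff₀ (by simpa [pR, Polynomial.leadingCoeff_map_of_injective hinj] using hlc)]
    have : (Finset.range pR.natDegree).sup (‖pR.coeff ·‖₊) ≤ Real.toNNReal Q * ‖pR.leadingCoeff‖₊ := by
      refine Finset.sup_le fun i _ ↦ ?_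
      rw [← NNReal.coe_le_coe]
      push_cast
      rw [Real.coe_toNNReal _ (by linarith), ← div_le_iff₀
        (by simpa [pR, Polynomial.leadingCoeff_map_of_injective hinj] using hlc)]
      simpa [pR, Polynomial.leadingCoeff_map_of_injective hinj] using hratio i
    have h := NNReal.coe_le_coe.2 this
    push_cast at h
    rwa [Real.coe_toNNReal _ (by linarith)] at h
  have : 10 * Q ≤ threshold P := le_max_left _ _
  linarith

open Polynomial in
theorem norm_gaussSum (P : MvPolynomial (Fin 2) ℤ) (a : ℤ) (q : ℕ) [NeZero q] (t : ℤ) :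
    ‖gaussSum P a q t‖ = expSumAvg ((C a * fibre P t).map (Int.castRingHom (ZMod q))) := by
  rw [gaussSum, expSumAvg, norm_mul, ← ZMod.sum_Icc_natCast q fun x ↦
    ZMod.stdAddChar (((C a * fibre P t).map (Int.castRingHom (ZMod q))).eval x)]
  congr 1
  · simp
  · congr 1
    refine Finset.sum_congr rfl fun s _ ↦ ?_
    have h : ((C a * fibre P t).map (Int.castRingHom (ZMod q))).eval (s : ZMod q) =
        ((a * value P s t : ℤ) : ZMod q) := by
      rw [← eval_fibre, ← eval_C_mul]
      exact eval_natCast_map (Int.castRingHom (ZMod q)) (C a * fibre P t) s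
    rw [h, ZMod.stdAddChar_coe]
    congr 1
    push_cast
    ring

/-- The gcd divides `a b` and, as a divisor of `q`, is coprime to `a`. This removes `a` uniformly.
-/
theorem gcd_val_intCast_mul_dvd {q : ℕ} [NeZero q] {a : ℤ} (ha : IsCoprime a (q : ℤ)) (b : ℤ) :
    (Nat.gcd q ((a * b : ℤ) : ZMod q).val : ℤ) ∣ b := by
  set g := Nat.gcd q ((a * b : ℤ) : ZMod q).val
  have hgq : (g : ℤ) ∣ q := by exact_mod_cast Nat.gcd_dvd_left _ _
  have hgv : (g : ℤ) ∣ (((a * b : ℤ) : ZMod q).val : ℤ) := by exact_mod_cast Nat.gcd_dvd_right _ _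
  rw [ZMod.val_intCast, EuclideanDomain.dvd_mod_iff hgq] at hgv
  exact (ha.of_isCoprime_of_dvd_right hgq).symm.dvd_of_dvd_mul_left hgv

end GaussAverage

/-! ### Averaging over the dyadic block -/

theorem mainTheorem3 (P : MvPolynomial (Fin 2) ℤ) (hP : 0 < P.degreeOf 0) :
    ∃ δ : ℝ, 0 < δ ∧ ∃ C : ℝ, 0 < C ∧
      ∀ (j₂ : ℕ), GaussAverage.threshold P ≤ (2 : ℝ) ^ j₂ →
        ∀ (q : ℕ) (a : ℤ), 1 ≤ q → IsCoprime a (q : ℤ) →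
          (1 / (2 : ℝ) ^ j₂) *
              ∑ t₂ ∈ GaussAverage.dyadic j₂, ‖GaussAverage.gaussSum P a q t₂‖
            ≤ C * (q : ℝ) ^ (-δ) := by
  classical
  obtain ⟨d, hd⟩ : ∃ d, P.degreeOf 0 = d + 1 := ⟨_, (Nat.succ_pred_eq_of_pos hP).symm⟩
  have hp := GaussAverage.fibreCoeff_degreeOf_ne_zero hP
  obtain ⟨K₁, hK₁, δ₁, hδ₁, h₁⟩ := exists_expSumAvg_le_rpow d
  obtain ⟨K₂, hK₂, δ₂, hδ₂, h₂⟩ := Polynomial.exists_card_large_common_divisor_le _ hp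
  refine ⟨min δ₁ δ₂, lt_min hδ₁ hδ₂, 3 * K₁ + K₂, by positivity, fun j hj q a hq ha ↦ ?_⟩
  have : NeZero q := ⟨by omega⟩
  have hq1 : (1 : ℝ) ≤ q := by exact_mod_cast hq
  have hNZ : (1 : ℤ) ≤ 2 ^ j := one_le_pow₀ (by norm_num)
  have hN : (0 : ℝ) < 2 ^ j := by positivity
  set F : ℤ → Polynomial (ZMod q) := fun t ↦
    (Polynomial.C a * GaussAverage.fibre P t).map (Int.castRingHom (ZMod q))
  set g : ℤ → ℕ := fun t ↦ Nat.gcd q ((F t).coeff (d + 1)).val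
  have hg (t : ℤ) : (g t : ℤ) ∣ (GaussAverage.fibreCoeff P (P.degreeOf 0)).eval t := by
    have : (F t).coeff (d + 1) =
        ((a * (GaussAverage.fibreCoeff P (P.degreeOf 0)).eval t : ℤ) : ZMod q) := by
      simp [F, hd, GaussAverage.coeff_fibre]
    simp only [g, this]
    exact GaussAverage.gcd_val_intCast_mul_dvd ha _
  have hFdeg (t : ℤ) : (F t).natDegree ≤ d + 1 := by
    rw [← hd]
    exact Polynomial.natDegree_map_le.trans
      ((Polynomial.natDegree_C_mul_le _ _).trans (GaussAverage.natDegree_fibre_le P t))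
  have hdy : ∀ t ∈ GaussAverage.dyadic j, |t| ≤ 2 ^ j ∧ (2 : ℤ) ^ j ≤ 2 * |t| := fun t ht ↦
    ⟨abs_le.2 (Finset.mem_Icc.1 (Finset.mem_filter.1 ht).1), (Finset.mem_filter.1 ht).2⟩
  have hdycard : ((GaussAverage.dyadic j).card : ℝ) ≤ 3 * 2 ^ j := by
    have h1 : ((GaussAverage.dyadic j).card : ℤ) ≤ (Finset.Icc (-(2 : ℤ) ^ j) (2 ^ j)).card := by
      exact_mod_cast Finset.card_le_card (Finset.filter_subset _ _)
    rw [Int.card_Icc, Int.toNat_of_nonneg (by omega)] at h1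
    have h2 : ((GaussAverage.dyadic j).card : ℤ) ≤ 3 * 2 ^ j := by omega
    exact_mod_cast h2
  -- The exceptional `t₂`, where Weyl's bound is too weak.
  set B := (GaussAverage.dyadic j).filter fun t ↦ (q : ℝ) ^ (1 / 2 : ℝ) < g t
  have hB : (B.card : ℝ) ≤ K₂ * 2 ^ j * (q : ℝ) ^ (-δ₂) := by
    have := h₂ q (2 ^ j) hq hNZ B fun t ht ↦ by
      obtain ⟨ht1, ht2⟩ := Finset.mem_filter.1 ht
      refine ⟨(hdy t ht1).1, GaussAverage.eval_fibreCoeff_ne_zero hp (hj.trans ?_), g t,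
        Nat.gcd_dvd_left _ _, ht2, hg t⟩
      exact_mod_cast (hdy t ht1).2
    exact_mod_cast this
  have hpoint : ∀ t ∈ GaussAverage.dyadic j, ‖GaussAverage.gaussSum P a q t‖ ≤
      K₁ * (q : ℝ) ^ (-δ₁) + if (q : ℝ) ^ (1 / 2 : ℝ) < g t then 1 else 0 := by
    intro t _
    rw [GaussAverage.norm_gaussSum]
    split_ifs with h
    · exact (expSumAvg_le_one _).trans (le_add_of_nonneg_left (by positivity))
    · rw [add_zero]
      exact h₁ q (F t) (hFdeg t) (not_lt.1 h)
  have hmono {δ : ℝ} (hδ : min δ₁ δ₂ ≤ δ) : (q : ℝ) ^ (-δ) ≤ (q : ℝ) ^ (-min δ₁ δ₂) :=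
    Real.rpow_le_rpow_of_exponent_le hq1 (neg_le_neg hδ)
  have hsum : ∑ t ∈ GaussAverage.dyadic j, ‖GaussAverage.gaussSum P a q t‖ ≤
      2 ^ j * ((3 * K₁ + K₂) * (q : ℝ) ^ (-min δ₁ δ₂)) := by
    calc _ ≤ (GaussAverage.dyadic j).card * (K₁ * (q : ℝ) ^ (-δ₁)) + B.card := by
          refine (Finset.sum_le_sum hpoint).trans_eq ?_
          rw [Finset.sum_add_distrib, Finset.sum_const, nsmul_eq_mul, Finset.sum_boole]
      _ ≤ (3 * 2 ^ j) * (K₁ * (q : ℝ) ^ (-min δ₁ δ₂)) +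
            K₂ * 2 ^ j * (q : ℝ) ^ (-min δ₁ δ₂) := by
          gcongr ?_ * (_ * ?_) + ?_
          · exact hmono (min_le_left _ _)
          · exact hB.trans (mul_le_mul_of_nonneg_left (hmono (min_le_right _ _)) (by positivity))
      _ = _ := by ring
  rw [one_div, inv_mul_le_iff₀ hN]
  exact hsum
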